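/- Conventions. A *complete meet semilattice* is a partially ordered set in which every non-empty subset has a meet (greatest lower bound). An *order ideal* of a poset is a subset $I$ such that $x\le y\in I$ implies $x\in I$, with the induced order. A subset $I$ of a poset $L$ is *join-closed* if, whenever a subset of $I$ has a join in $L$, this join is in $I$. A *complete ortholattice* is a complete lattice $V$ with an order-reversing map $z\mapsto z^{\complement}$ such that $(z^{\complement})^{\complement}=z$, $z\vee z^{\complement}=1_V$ and $z\wedge z^{\complement}=0_V$ for all $z\in V$. An *orthogonality relation* on a non-empty complete meet semilattice $L$ (with minimum element $0_L$) is a subset $P\subseteq L\times L$ such that (i) $(x,y)\in P$ implies $(y,x)\in P$; (ii) for every $x\in L$, the set $\{y\in L\mid (x,y)\in P\}$ is a non-empty join-closed order ideal of $L$; (iii) $(a,a)\in P$ implies $a=0_L$. A *Boolean ring* is a ring, not necessarily with identity, in which $x^2=x$ for all $x$; it is ordered by $x\le y\iff xy=x$. A subset $L$ of a Boolean ring $R$, with the induced order, *satisfies the JOP* (join orthogonality property) if, whenever $X\subseteq L$ has a join $j$ in $L$ and $y\in L$ satisfies $xy=0$ for all $x\in X$, then $jy=0$. A *protorootoid* $(G,\Lambda,N)$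 consists of a groupoid $G$, a functor $\Lambda$ from $G$ to the category of Boolean rings and (not necessarily unital) ring homomorphisms, and a $1$-cocycle $N$: to each morphism $g\colon b\to a$ of $G$ is attached $N(g)\in\Lambda(a)$, and $N(gh)=N(g)+\Lambda(g)(N(h))$ for all $g\colon b\to a$, $h\colon c\to b$. For an object $a$, let ${}_aG$ be the set of all morphisms with codomain $a$; the *weak right preorder* on ${}_aG$ is given by $g\le h\iff N(g)\le N(h)$ in $\Lambda(a)$. The protorootoid is *faithful* if $N(g)=0$ only for identity morphisms $g$ (then the weak right preorders are partial orders, called weak right orders). A *rootoid* is a faithful protorootoid such that, for every object $a$, the set ${}_a\mathcal L=\{N(g)\mid g\in{}_aG\}\subseteq\Lambda(a)$ is a complete meet semilattice in the induced order and satisfies the JOP. The *weak right order* of a Coxeter system $(W,S)$ with length function $\ell$ is the partial order on $W$ given by $x\le y\iff \ell(y)=\ell(x)+\ell(x^{-1}y)$. **Statement.** 1. Let $L$ be a non-empty complete meet semilattice with an orthogonality relation $P$. There is an order isomorphism of $L$ with an order ideal of a complete ortholattice $V$. Moreover, these are canonically associated to $(L,P)$: one can choose a complete ortholattice $V(L,P)$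 and an order isomorphism $i_{(L,P)}$ of $L$ with an order ideal of $V(L,P)$ for all $(L,P)$ simultaneously, and for each order isomorphism $e\colon L\to L'$ such that $(x,y)\in P\iff(e(x),e(y))\in P'$ an order isomorphism $\varphi_e\colon V(L,P)\to V(L',P')$ commuting with $z\mapsto z^{\complement}$, such that $\varphi_{\mathrm{id}}=\mathrm{id}$, $\varphi_{f e}=\varphi_f\varphi_e$ and $\varphi_e\circ i_{(L,P)}=i_{(L',P')}\circ e$. 2. (a) Let $R$ be a Boolean ring and $L\subseteq R$ a subset with $0\in L$ which is a complete meet semilattice in the induced order and satisfies the JOP. Then $L$ is order isomorphic to an order ideal of a complete ortholattice. (b) Every weak right order of a rootoid is order isomorphic to an order ideal of a complete ortholattice. (c) The weak right order of any Coxeter system $(W,S)$ is order isomorphic to an order ideal of a complete ortholattice. -/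

import Mathlib

open CategoryTheory

universe u v w

/-! ### Complete meet semilattices, complete ortholattices, order ideals -/

/-- Every non-empty subset has a meet. -/
def IsCompleteMeetSemilattice (L : Type u) [PartialOrder L] : Prop :=
  ∀ s : Set L, s.Nonempty → ∃ m, IsGLB s m

/-- A complete lattice with an order-reversing involution `z ↦ zᶜ` such that `z ⊔ zᶜ = ⊤` and
`z ⊓ zᶜ = ⊥`. -/
class CompleteOrtholattice (V : Type u) extends CompleteLattice V, Compl V where
  compl_le_compl : ∀ x y : V, x ≤ y → yᶜ ≤ xᶜ
  compl_compl : ∀ x : V, xᶜᶜ = x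
  sup_compl : ∀ x : V, x ⊔ xᶜ = ⊤
  inf_compl : ∀ x : V, x ⊓ xᶜ = ⊥

/-- `X` is order isomorphic to an order ideal (that is, a lower set, with the induced order) of some
complete ortholattice. -/
def IsIdealOfCompleteOrtholattice (X : Type u) [LE X] : Prop :=
  ∃ (V : Type u) (_ : CompleteOrtholattice V) (I : LowerSet V), Nonempty (X ≃o I)

/-- A subset which contains every join, existing in `L`, of a subset of it. -/
def IsJoinClosed {L : Type u} [PartialOrder L] (I : Set L) : Prop :=
  ∀ X : Set L, X ⊆ I → ∀ j : L, IsLUB X j → j ∈ I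

/-- Orthogonality relations on a partially ordered set. -/
structure IsOrthogonalityRelation {L : Type u} [PartialOrder L] (P : L → L → Prop) : Prop where
  symm : ∀ x y, P x y → P y x
  nonempty : ∀ x, {y | P x y}.Nonempty
  isLowerSet : ∀ x, IsLowerSet {y | P x y}
  isJoinClosed : ∀ x, IsJoinClosed {y | P x y}
  isBot_of_self : ∀ a, P a a → IsBot a

/-- A non-empty complete meet semilattice together with an orthogonality relation. -/
structure OrthogonalitySemilattice : Type (u + 1) where
  carrier : Type u
  [partialOrder : PartialOrder carrier]
  [nonempty : Nonempty carrier]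
  isCompleteMeetSemilattice : IsCompleteMeetSemilattice carrier
  rel : carrier → carrier → Prop
  isOrthogonalityRelation : IsOrthogonalityRelation rel

attribute [instance] OrthogonalitySemilattice.partialOrder OrthogonalitySemilattice.nonempty

/-- Isomorphisms of semilattices with orthogonality relation: order isomorphisms which preserve and
reflect the relation. -/
structure OrthogonalitySemilattice.Iso (A B : OrthogonalitySemilattice.{u}) where
  toOrderIso : A.carrier ≃o B.carrier
  rel_iff : ∀ x y, B.rel (toOrderIso x) (toOrderIso y) ↔ A.rel x y

/-- The identity isomorphism. -/
def OrthogonalitySemilattice.Iso.refl (A : OrthogonalitySemilattice.{u}) : A.Iso A :=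
  ⟨OrderIso.refl _, fun _ _ => Iff.rfl⟩

/-- The composite `A → B → C` of two isomorphisms. -/
def OrthogonalitySemilattice.Iso.trans {A B C : OrthogonalitySemilattice.{u}}
    (e : A.Iso B) (f : B.Iso C) : A.Iso C :=
  ⟨e.toOrderIso.trans f.toOrderIso, fun x y => (f.rel_iff _ _).trans (e.rel_iff x y)⟩

/-! ### Boolean rings (possibly without identity element) and protomeshes -/

/-- A Boolean ring: a ring, not necessarily with identity, in which every element is idempotent. -/
class BooleanRng (R : Type u) extends NonUnitalRing R where
  mul_self : ∀ x : R, x * x = x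

theorem BooleanRng.mul_comm' {R : Type u} [BooleanRng R] (x y : R) : x * y = y * x := by
  have add_self : ∀ z : R, z + z = 0 := fun z => by
    have h := BooleanRng.mul_self (z + z)
    rw [mul_add, add_mul, BooleanRng.mul_self] at h
    exact add_eq_left.mp h
  have h := BooleanRng.mul_self (x + y)
  rw [mul_add, add_mul, add_mul, BooleanRng.mul_self, BooleanRng.mul_self] at h
  have h1 : x + y + (y * x + x * y) = x + y := by
    calc x + y + (y * x + x * y) = x + y * x + (x * y + y) := by abel
      _ = x + y := h
  exact (add_right_cancel ((add_eq_left.mp h1).trans (add_self (x * y)).symm)).symm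

/-- The natural order of a Boolean ring: `x ≤ y` if `x y = x`. For the ring of subsets of a set this
is inclusion, and `x * y` is the intersection. -/
instance BooleanRng.instPartialOrder {R : Type u} [BooleanRng R] : PartialOrder R where
  le x y := x * y = x
  le_refl x := BooleanRng.mul_self x
  le_trans x y z (hxy : x * y = x) (hyz : y * z = y) := by
    rw [← hxy, mul_assoc, hyz]
  le_antisymm x y (hxy : x * y = x) (hyx : y * x = y) := by
    rw [← hxy, BooleanRng.mul_comm', hyx]

/-- The join orthogonality property of a protomesh `(R, L)`, that is, of a subset `L` of a Boolean
ring `R`: if a subset `X` of `L` has a join `j` in `L` (for the order induced by `R`) and `y ∈ L` is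
orthogonal to all elements of `X`, then `y` is orthogonal to `j`. -/
def SatisfiesJOP {R : Type u} [BooleanRng R] (L : Set R) : Prop :=
  ∀ (X : Set L) (j : L), IsLUB X j → ∀ y : L,
    (∀ x ∈ X, (x : R) * (y : R) = 0) → (j : R) * (y : R) = 0

/-! ### Protorootoids and rootoids -/

/-- A protorootoid with underlying groupoid `G`: a representation of `G` in the category of Boolean
rings, given by Boolean rings `obj a` and actions `act g : obj b → obj a` of the morphisms
`g : b ⟶ a`, and a 1-cocycle `N` with `N g ∈ obj a` for `g : b ⟶ a`. The product of `g : b ⟶ a` and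
`h : c ⟶ b`, written `g h` when morphisms are composed from right to left, is `h ≫ g`. -/
structure Protorootoid (G : Type u) [Groupoid.{v} G] where
  obj : G → Type w
  [ring : ∀ a, BooleanRng (obj a)]
  act : ∀ {b a : G}, (b ⟶ a) → (obj b →ₙ+* obj a)
  act_id : ∀ (a : G) (x : obj a), act (𝟙 a) x = x
  act_comp : ∀ {c b a : G} (h : c ⟶ b) (g : b ⟶ a) (x : obj c), act (h ≫ g) x = act g (act h x)
  N : ∀ {b a : G}, (b ⟶ a) → obj a
  cocycle : ∀ {c b a : G} (h : c ⟶ b) (g : b ⟶ a), N (h ≫ g) = N g + act g (N h)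

attribute [instance] Protorootoid.ring

namespace Protorootoid

variable {G : Type u} [Groupoid.{v} G] (R : Protorootoid.{u, v, w} G)

/-- The set of all morphisms of `G` with codomain `a`, regarded as the underlying set of the weak
right (pre)order of `R` at `a`. -/
def WeakRight (_ : Protorootoid.{u, v, w} G) (a : G) : Type (max u v) := Σ b : G, (b ⟶ a)

/-- The weak right preorder at `a`: `g ≤ h` if `N g ≤ N h` in the Boolean ring at `a`. -/
instance (a : G) : Preorder (R.WeakRight a) := Preorder.lift fun g => R.N g.2

/-- The big weak order at `a`: the set of values of the cocycle at morphisms with codomain `a`. -/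
def bigWeakOrder (a : G) : Set (R.obj a) := Set.range fun g : R.WeakRight a => R.N g.2

/-- Only identity morphisms have cocycle value zero; equivalently, the weak right preorders are
partial orders. -/
def IsFaithful : Prop :=
  ∀ (a : G) (g : R.WeakRight a), R.N g.2 = 0 → g = (⟨a, 𝟙 a⟩ : Σ b : G, (b ⟶ a))

/-- A rootoid is a faithful protorootoid whose weak orders are complete meet semilattices and
satisfy the join orthogonality property. By faithfulness, `g ↦ N g` is an order isomorphism from
the weak right order at `a` to the big weak order at `a`. -/
structure IsRootoid : Prop where
  isFaithful : R.IsFaithful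
  isCompleteMeetSemilattice : ∀ a, IsCompleteMeetSemilattice (R.bigWeakOrder a)
  satisfiesJOP : ∀ a, SatisfiesJOP (R.bigWeakOrder a)

end Protorootoid

/-! ### The weak right order of a Coxeter system -/

/-- The relation `x ≤ y` if `ℓ(y) = ℓ(x) + ℓ(x⁻¹ y)`: some reduced expression of `x` is an initial
part of a reduced expression of `y`. -/
def CoxeterWeakRightLE {B : Type u} {W : Type v} [Group W] {M : CoxeterMatrix B}
    (cs : CoxeterSystem M W) (x y : W) : Prop :=
  cs.length y = cs.length x + cs.length (x⁻¹ * y)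

/-- The group of a Coxeter system, regarded as the underlying set of the weak right order. -/
def CoxeterWeakRight {B : Type u} {W : Type v} [Group W] {M : CoxeterMatrix B}
    (_ : CoxeterSystem M W) : Type v := W

/-- The weak right order of a Coxeter system. -/
instance {B : Type u} {W : Type v} [Group W] {M : CoxeterMatrix B} (cs : CoxeterSystem M W) :
    PartialOrder (CoxeterWeakRight cs) where
  le x y := @CoxeterWeakRightLE B W _ M cs x y
  le_refl := fun (x : W) => by
    change cs.length x = cs.length x + cs.length (x⁻¹ * x)
    simp
  le_trans := fun (x y z : W) (hxy : cs.length y = cs.length x + cs.length (x⁻¹ * y))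
      (hyz : cs.length z = cs.length y + cs.length (y⁻¹ * z)) => by
    have h1 := cs.length_mul_le x (x⁻¹ * z)
    have h2 := cs.length_mul_le (x⁻¹ * y) (y⁻¹ * z)
    simp only [mul_assoc, mul_inv_cancel_left] at h1 h2
    change cs.length z = cs.length x + cs.length (x⁻¹ * z)
    omega
  le_antisymm := fun (x y : W) (hxy : cs.length y = cs.length x + cs.length (x⁻¹ * y))
      (hyx : cs.length x = cs.length y + cs.length (y⁻¹ * x)) => by
    have h : cs.length (x⁻¹ * y) = 0 := by omega
    exact (@inv_mul_eq_one W _ x y).mp (cs.length_eq_zero_iff.mp h)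

/-!
Let `L` be a complete meet semilattice with orthogonality relation `P`. Take two copies of `L`, the
second one consisting of formal complements, and let `x` be related to `y` if `P x y`, and to the
formal complement of `y` if `x ≤ y` (`doubledRel`). This relation is symmetric, and the only elements
related to themselves are those related to everything, so that its lattice of formal concepts (the
sets equal to their double polar) is a complete ortholattice (`Concept.completeOrtholattice`). The
concept generated by `x : L` has the principal ideal of `x` as its extent, whence an order embedding
of `L`. A concept below a principal one is an intersection of join-closed lower sets of `L` and is
bounded, so it is principal too: the image is an order ideal
(`IsOrthogonalityRelation.exists_eq_ofObject_of_le`). The construction is visibly functorial for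
isomorphisms.

For subsets of Boolean rings, `x y = 0` is an orthogonality relation; its sections are join-closed by
the join orthogonality property. The weak orders of rootoids embed in Boolean rings by their cocycle.

For a Coxeter group with the weak order, the relation is `ℓ(x⁻¹ y) = ℓ(x) + ℓ(y)`. What has to be
proved is that bounded pairs have joins, and that these joins respect orthogonality. A lemma of
Björner, Edelman and Ziegler (`exists_isLUB_pair_of_local`) reduces this to pairs of elements
covering a common element `z`, and left translation by `z⁻¹` moves such a pair to a pair of simple
reflections. If all simple reflections in a set `J` are left descents of `a`, then by the exchange
property the whole parabolic subgroup of `J` lies below `a` (`weakRightLE_of_mem_parabolic`); hence a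
longest element of this subgroup is the join of `J`, and an element without right descents in `J`
has additive lengths with the parabolic subgroup (`length_mul_of_mem_parabolic`), which is the
statement about orthogonality. The exchange property itself comes from the action of the group on
signed elements, in which a simple reflection conjugates and changes the sign of itself alone
(`signedConjHom`).
-/

/-! ### Formal concepts of a symmetric relation -/

namespace Concept

variable {X : Type u} {r : X → X → Prop}

/-- The concept lattice of a symmetric relation is a complete ortholattice, with complement
exchanging extent and intent, as soon as elements related to themselves are related to every
element. -/
@[reducible] def completeOrtholattice (hs : ∀ x y, r x y → r y x)
    (h : ∀ x, r x x → ∀ y, r x y) : CompleteOrtholattice (Concept X X r) where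
  compl c :=
    { extent := c.intent
      intent := c.extent
      upperPolar_extent := by
        conv_rhs => rw [← c.lowerPolar_intent]
        ext x
        exact ⟨fun hx y hy => hs _ _ (hx hy), fun hx y hy => hs _ _ (hx hy)⟩
      lowerPolar_intent := by
        conv_rhs => rw [← c.upperPolar_extent]
        ext x
        exact ⟨fun hx y hy => hs _ _ (hx hy), fun hx y hy => hs _ _ (hx hy)⟩ }
  compl_le_compl _ _ hcd := intent_subset_intent_iff.mpr hcd
  compl_compl _ := rfl
  sup_compl c := by
    apply Concept.ext'
    refine Set.Subset.antisymm (fun x hx y _ => ?_) (fun x hx => ?_)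
    · rw [intent_sup] at hx
      exact hs _ _ (h x (rel_extent_intent hx.2 hx.1) y)
    · exact Set.mem_of_subset_of_mem (intent_subset_intent_iff.mpr le_top) hx
  inf_compl c := by
    apply Concept.ext
    refine Set.Subset.antisymm (fun x hx y _ => ?_) (fun x hx => ?_)
    · rw [extent_inf] at hx
      exact h x (rel_extent_intent hx.1 hx.2) y
    · exact Set.mem_of_subset_of_mem (extent_subset_extent_iff.mpr bot_le) hx

section MapEquiv

variable {Y : Type v} {r' : Y → Y → Prop}

theorem upperPolar_preimage_symm (e : X ≃ Y) (he : ∀ x y, r' (e x) (e y) ↔ r x y) (s : Set X) :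
    upperPolar r' (e.symm ⁻¹' s) = e.symm ⁻¹' upperPolar r s := by
  ext y
  obtain ⟨y, rfl⟩ := e.surjective y
  simp only [mem_upperPolar_iff, Set.mem_preimage, e.surjective.forall, e.symm_apply_apply, he]

theorem lowerPolar_preimage_symm (e : X ≃ Y) (he : ∀ x y, r' (e x) (e y) ↔ r x y) (s : Set X) :
    lowerPolar r' (e.symm ⁻¹' s) = e.symm ⁻¹' lowerPolar r s := by
  ext y
  obtain ⟨y, rfl⟩ := e.surjective y
  simp only [mem_lowerPolar_iff, Set.mem_preimage, e.surjective.forall, e.symm_apply_apply, he]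

/-- The image of a concept under a bijection compatible with the relations. -/
def map (e : X ≃ Y) (he : ∀ x y, r' (e x) (e y) ↔ r x y) (c : Concept X X r) :
    Concept Y Y r' where
  extent := e.symm ⁻¹' c.extent
  intent := e.symm ⁻¹' c.intent
  upperPolar_extent := by rw [upperPolar_preimage_symm e he, c.upperPolar_extent]
  lowerPolar_intent := by rw [lowerPolar_preimage_symm e he, c.lowerPolar_intent]

/-- A bijection compatible with the relations induces an isomorphism of concept lattices. -/
def mapEquiv (e : X ≃ Y) (he : ∀ x y, r' (e x) (e y) ↔ r x y) :
    Concept X X r ≃o Concept Y Y r' where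
  toFun := map e he
  invFun := map e.symm fun x y => by rw [← he, e.apply_symm_apply, e.apply_symm_apply]
  left_inv c := Concept.ext (by ext; simp [map])
  right_inv c := Concept.ext (by ext; simp [map])
  map_rel_iff' {c d} := by
    rw [← extent_subset_extent_iff, ← extent_subset_extent_iff]
    exact Set.preimage_subset_preimage_iff (by simp [e.symm.surjective.range_eq])

end MapEquiv

end Concept

/-! ### The complete ortholattice of a semilattice with orthogonality relation -/

section Doubling

variable {L : Type u} [PartialOrder L] {P : L → L → Prop}

/-- The relation on two copies of `L`, the second of which consists of formal complements:
`x` and `y` are related if `P x y`, and `x` is related to the formal complement of `y` if `x ≤ y`.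
Formal complements are never related to each other. -/
def doubledRel (P : L → L → Prop) : L ⊕ L → L ⊕ L → Prop
  | .inl x, .inl y => P x y
  | .inl x, .inr y => x ≤ y
  | .inr x, .inl y => y ≤ x
  | .inr _, .inr _ => False

namespace IsOrthogonalityRelation

variable (hP : IsOrthogonalityRelation P)
include hP

theorem rel_of_isBot {b : L} (hb : IsBot b) (x : L) : P b x := by
  obtain ⟨y, hy⟩ := hP.nonempty x
  exact hP.symm _ _ (hP.isLowerSet x (hb y) hy)

theorem doubledRel_symm (x y : L ⊕ L) (h : doubledRel P x y) : doubledRel P y x := by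
  rcases x with x | x <;> rcases y with y | y
  · exact hP.symm x y h
  · exact h
  · exact h
  · exact h

theorem doubledRel_of_self (x : L ⊕ L) (h : doubledRel P x x) (y : L ⊕ L) :
    doubledRel P x y := by
  rcases x with x | x
  · rcases y with y | y
    · exact hP.rel_of_isBot (hP.isBot_of_self x h) y
    · exact hP.isBot_of_self x h y
  · exact h.elim

/-- The extent of the concept generated by `x` is the principal ideal generated by `x`. -/
theorem mem_extent_ofObject {x : L} {z : L ⊕ L} :
    z ∈ (Concept.ofObject (doubledRel P) (.inl x)).extent ↔ ∃ y ≤ x, z = .inl y := by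
  constructor
  · intro hz
    have h := hz (b := .inr x) (by simp [doubledRel])
    rcases z with z | z
    · exact ⟨z, h, rfl⟩
    · exact h.elim
  · rintro ⟨y, hy, rfl⟩ (b | b) hb
    · exact hP.symm _ _ (hP.isLowerSet b hy (hP.symm _ _ (by simpa [doubledRel] using hb)))
    · exact hy.trans (by simpa [doubledRel] using hb)

theorem ofObject_le_iff {x : L} {c : Concept (L ⊕ L) (L ⊕ L) (doubledRel P)} :
    Concept.ofObject (doubledRel P) (.inl x) ≤ c ↔ Sum.inl x ∈ c.extent := by
  rw [← Concept.extent_subset_extent_iff]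
  refine ⟨fun h => h (hP.mem_extent_ofObject.mpr ⟨x, le_rfl, rfl⟩), fun hx z hz => ?_⟩
  rw [← c.lowerPolar_intent] at hx ⊢
  exact fun b hb => hz (by simpa using hx hb)

/-- A concept below a principal one is principal: its extent is an intersection of join-closed
lower sets of `L`, and in a complete meet semilattice bounded subsets have joins. -/
theorem exists_eq_ofObject_of_le [Nonempty L] (hL : IsCompleteMeetSemilattice L) {x : L}
    {c : Concept (L ⊕ L) (L ⊕ L) (doubledRel P)}
    (hc : c ≤ Concept.ofObject (doubledRel P) (.inl x)) :
    ∃ y, Concept.ofObject (doubledRel P) (.inl y) = c := by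
  have hcx : ∀ z ∈ c.extent, ∃ y ≤ x, z = .inl y := fun z hz =>
    hP.mem_extent_ofObject.mp (Concept.extent_subset_extent_iff.mpr hc hz)
  -- the join of the extent is the meet of its upper bounds
  obtain ⟨j, hj⟩ := hL (upperBounds {y | Sum.inl y ∈ c.extent})
    ⟨x, fun y hy => by obtain ⟨y', h, e⟩ := hcx _ hy; rw [Sum.inl.inj e]; exact h⟩
  rw [isGLB_upperBounds] at hj
  refine ⟨j, le_antisymm (hP.ofObject_le_iff.mpr ?_) ?_⟩
  · rw [← c.lowerPolar_intent]
    rintro (b | b) hb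
    · refine hP.symm _ _ (hP.isJoinClosed b _ (fun y hy => ?_) j hj)
      exact hP.symm _ _ (Concept.rel_extent_intent (r := doubledRel P) hy hb)
    · exact hj.2 fun y hy => Concept.rel_extent_intent (r := doubledRel P) hy hb
  · rw [← Concept.extent_subset_extent_iff]
    intro z hz
    obtain ⟨y, -, rfl⟩ := hcx z hz
    exact hP.mem_extent_ofObject.mpr ⟨y, hj.1 hz, rfl⟩

omit hP in
/-- The order ideal of the concepts generated by elements of `L`. -/
def principalConcepts [Nonempty L] (hL : IsCompleteMeetSemilattice L)
    (hP : IsOrthogonalityRelation P) : LowerSet (Concept (L ⊕ L) (L ⊕ L) (doubledRel P)) where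
  carrier := Set.range fun x => Concept.ofObject (doubledRel P) (.inl x)
  lower' := by
    rintro _ c hc ⟨x, rfl⟩
    exact hP.exists_eq_ofObject_of_le hL hc

omit hP in
/-- The isomorphism of `L` with an order ideal of the concept lattice of the doubled relation. -/
noncomputable def orderIsoPrincipalConcepts [Nonempty L] (hL : IsCompleteMeetSemilattice L)
    (hP : IsOrthogonalityRelation P) : L ≃o principalConcepts hL hP where
  toEquiv := Equiv.ofBijective
    (fun x => ⟨Concept.ofObject (doubledRel P) (.inl x), x, rfl⟩)
    ⟨fun x y hxy => by
      have h : ∀ {x y : L}, Concept.ofObject (doubledRel P) (.inl x) =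
          Concept.ofObject (doubledRel P) (.inl y) → x ≤ y := fun h => by
        obtain ⟨z, hz, e⟩ := hP.mem_extent_ofObject.mp (hP.ofObject_le_iff.mp h.le)
        rw [Sum.inl.inj e]
        exact hz
      have hxy := congrArg Subtype.val hxy
      exact le_antisymm (h hxy) (h hxy.symm),
     by rintro ⟨_, x, rfl⟩; exact ⟨x, rfl⟩⟩
  map_rel_iff' {x y} := by
    refine (hP.ofObject_le_iff (x := x) (c := Concept.ofObject _ (.inl y))).trans ?_
    rw [hP.mem_extent_ofObject]
    exact ⟨fun ⟨z, hz, e⟩ => by rw [Sum.inl.inj e]; exact hz, fun h => ⟨x, h, rfl⟩⟩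

theorem isIdealOfCompleteOrtholattice [Nonempty L] (hL : IsCompleteMeetSemilattice L) :
    IsIdealOfCompleteOrtholattice L :=
  ⟨_, Concept.completeOrtholattice hP.doubledRel_symm hP.doubledRel_of_self,
    principalConcepts hL hP, ⟨orderIsoPrincipalConcepts hL hP⟩⟩

end IsOrthogonalityRelation

end Doubling

namespace OrthogonalitySemilattice

/-- The complete ortholattice attached to a semilattice with orthogonality relation. -/
abbrev Ortholattice (A : OrthogonalitySemilattice.{u}) : Type u :=
  Concept (A.carrier ⊕ A.carrier) (A.carrier ⊕ A.carrier) (doubledRel A.rel)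

instance (A : OrthogonalitySemilattice.{u}) : CompleteOrtholattice A.Ortholattice :=
  Concept.completeOrtholattice A.isOrthogonalityRelation.doubledRel_symm
    A.isOrthogonalityRelation.doubledRel_of_self

/-- Functoriality of `Ortholattice` for isomorphisms. -/
def Iso.ortholattice {A B : OrthogonalitySemilattice.{u}} (e : A.Iso B) :
    A.Ortholattice ≃o B.Ortholattice :=
  Concept.mapEquiv (Equiv.sumCongr e.toOrderIso.toEquiv e.toOrderIso.toEquiv) fun x y => by
    rcases x with x | x <;> rcases y with y | y
    · exact e.rel_iff x y
    · exact e.toOrderIso.le_iff_le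
    · exact e.toOrderIso.le_iff_le
    · exact Iff.rfl

theorem Iso.ortholattice_ofObject {A B : OrthogonalitySemilattice.{u}} (e : A.Iso B)
    (x : A.carrier) : e.ortholattice (Concept.ofObject (doubledRel A.rel) (.inl x)) =
      Concept.ofObject (doubledRel B.rel) (.inl (e.toOrderIso x)) := by
  apply Concept.ext
  ext z
  rw [B.isOrthogonalityRelation.mem_extent_ofObject]
  refine Iff.trans (A.isOrthogonalityRelation.mem_extent_ofObject
    (z := (Equiv.sumCongr e.toOrderIso.toEquiv e.toOrderIso.toEquiv).symm z)) ?_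
  constructor
  · rintro ⟨y, hy, h⟩
    exact ⟨e.toOrderIso y, e.toOrderIso.monotone hy, by
      rw [Equiv.symm_apply_eq] at h; exact h⟩
  · rintro ⟨y, hy, rfl⟩
    exact ⟨e.toOrderIso.symm y, by simpa using e.toOrderIso.symm.monotone hy, rfl⟩

end OrthogonalitySemilattice

/-! ### Boolean rings and rootoids -/

namespace BooleanRng

/-- Disjointness of values in a Boolean ring is an orthogonality relation on a poset embedded in the
ring, provided that the join orthogonality property holds. -/
theorem isOrthogonalityRelation {R : Type v} [BooleanRng R] {L : Type u} [PartialOrder L]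
    (f : L → R) (hf : ∀ x y, x ≤ y ↔ f x ≤ f y) (h0 : ∃ x, f x = 0)
    (hJ : SatisfiesJOP (Set.range f)) : IsOrthogonalityRelation fun x y => f x * f y = 0 where
  symm x y h := by rw [mul_comm', h]
  nonempty x := by
    obtain ⟨z, hz⟩ := h0
    exact ⟨z, show f x * f z = 0 by rw [hz, mul_zero]⟩
  isLowerSet x y z hzy hy := by
    have hzy : f z * f y = f z := (hf z y).mp hzy
    have hy : f x * f y = 0 := hy
    change f x * f z = 0
    rw [← hzy, mul_comm' (f z), ← mul_assoc, hy, zero_mul]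
  isJoinClosed x X hX j hj := by
    change f x * f j = 0
    rw [mul_comm']
    refine hJ (Set.rangeFactorization f '' X) ⟨f j, j, rfl⟩ (And.intro ?_ ?_) ⟨f x, x, rfl⟩ ?_
    · rintro _ ⟨y, hy, rfl⟩
      exact (hf y j).mp (hj.1 hy)
    · rintro ⟨_, b, rfl⟩ hb
      exact (hf j b).mp (hj.2 fun y hy => (hf y b).mpr (hb ⟨y, hy, rfl⟩))
    · rintro _ ⟨y, hy, rfl⟩
      exact (mul_comm' _ _).trans (hX hy)
  isBot_of_self a h y := by
    rw [BooleanRng.mul_self] at h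
    rw [hf, h]
    exact zero_mul (f y)

/-- A poset order isomorphic to a subset of a Boolean ring with the join orthogonality property. -/
theorem isIdealOfCompleteOrtholattice {R : Type v} [BooleanRng R] {L : Type u} [PartialOrder L]
    (f : L → R) (hf : ∀ x y, x ≤ y ↔ f x ≤ f y) (h0 : ∃ x, f x = 0)
    (hL : IsCompleteMeetSemilattice (Set.range f)) (hJ : SatisfiesJOP (Set.range f)) :
    IsIdealOfCompleteOrtholattice L := by
  obtain ⟨x0, -⟩ := id h0
  have : Nonempty L := ⟨x0⟩
  refine (isOrthogonalityRelation f hf h0 hJ).isIdealOfCompleteOrtholattice fun s hs => ?_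
  obtain ⟨⟨_, m, rfl⟩, hm⟩ := hL (Set.rangeFactorization f '' s) (hs.image _)
  refine ⟨m, fun y hy => (hf m y).mpr (hm.1 ⟨y, hy, rfl⟩), fun b hb => (hf b m).mpr ?_⟩
  refine (le_isGLB_iff (b := ⟨f b, b, rfl⟩) hm).mpr ?_
  rintro _ ⟨y, hy, rfl⟩
  exact (hf b y).mp (hb hy)

end BooleanRng

namespace Protorootoid

variable {G : Type u} [Groupoid.{v} G] (R : Protorootoid.{u, v, w} G)

theorem N_id (a : G) : R.N (𝟙 a) = 0 := by
  have h := R.cocycle (𝟙 a) (𝟙 a)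
  rw [Category.comp_id, R.act_id] at h
  exact left_eq_add.mp h

/-- In a faithful protorootoid, a morphism is determined by its codomain and its cocycle value. -/
theorem IsFaithful.injective (h : R.IsFaithful) (a : G) :
    Function.Injective fun g : R.WeakRight a => R.N g.2 := by
  rintro ⟨b, g⟩ ⟨c, k⟩ (hgk : R.N g = R.N k)
  -- `k ≫ g⁻¹` has cocycle value zero
  have hk : R.N g = R.N g + R.act g (R.N (k ≫ inv g)) := by
    rw [← R.cocycle, Category.assoc, IsIso.inv_hom_id, Category.comp_id, hgk]
  have hk' : R.N (k ≫ inv g) = 0 := by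
    have h1 := congrArg (R.act (inv g)) (left_eq_add.mp hk)
    rwa [← R.act_comp, IsIso.hom_inv_id, R.act_id, map_zero] at h1
  have h2 := h b ⟨c, k ≫ inv g⟩ hk'
  obtain ⟨rfl, h3⟩ := Sigma.mk.inj_iff.mp h2
  have h4 : k ≫ inv g = 𝟙 c := eq_of_heq h3
  rw [IsIso.comp_inv_eq, Category.id_comp] at h4
  rw [h4]

theorem IsRootoid.isIdealOfCompleteOrtholattice (h : R.IsRootoid) (a : G) :
    IsIdealOfCompleteOrtholattice (R.WeakRight a) := by
  let _ : PartialOrder (R.WeakRight a) :=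
    { (inferInstance : Preorder (R.WeakRight a)) with
      le_antisymm := fun _ _ h1 h2 => h.isFaithful.injective R a (le_antisymm h1 h2) }
  exact BooleanRng.isIdealOfCompleteOrtholattice (fun g : R.WeakRight a => R.N g.2)
    (fun _ _ => Iff.rfl) ⟨⟨a, 𝟙 a⟩, R.N_id a⟩ (h.isCompleteMeetSemilattice a) (h.satisfiesJOP a)

end Protorootoid

/-! ### Bounded joins in graded posets -/

section Posets

variable {α : Type u} [PartialOrder α] {rk : α → ℕ} {C : Set α}

/-- A form of the lemma of Björner, Edelman and Ziegler. Suppose that above `z`, below two elements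
`y₁`, `y₂ > z` with a common upper bound, there are always `x₁`, `x₂ > z` with a join. Then any two
elements with a common upper bound have a join. If the lower set `C` contains the given joins of
pairs of its elements, then it contains all joins of pairs of its elements. -/
theorem exists_isLUB_pair_of_local (hrk : StrictMono rk) (hC : IsLowerSet C)
    (h : ∀ z y₁ y₂ a, z < y₁ → z < y₂ → y₁ ≤ a → y₂ ≤ a → ∃ x₁ x₂ q, z < x₁ ∧ x₁ ≤ y₁ ∧
      z < x₂ ∧ x₂ ≤ y₂ ∧ IsLUB {x₁, x₂} q ∧ (x₁ ∈ C → x₂ ∈ C → q ∈ C))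
    {z y₁ y₂ a : α} (h₁ : z ≤ y₁) (h₂ : z ≤ y₂) (h₁a : y₁ ≤ a) (h₂a : y₂ ≤ a) :
    ∃ j, IsLUB {y₁, y₂} j ∧ (y₁ ∈ C → y₂ ∈ C → j ∈ C) := by
  induction hn : rk a - rk z using Nat.strong_induction_on generalizing z y₁ y₂ with
  | _ n ih =>
    subst hn
    rcases h₁.eq_or_lt with rfl | h₁
    · exact ⟨y₂, by simp [IsLUB, IsLeast, upperBounds_insert, h₂, mem_lowerBounds],
        fun _ h => h⟩
    rcases h₂.eq_or_lt with rfl | h₂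
    · exact ⟨y₁, by simp [IsLUB, IsLeast, upperBounds_insert, h₁.le, mem_lowerBounds]; tauto,
        fun h _ => h⟩
    obtain ⟨x₁, x₂, q, hx₁, hxy₁, hx₂, hxy₂, hq, hqC⟩ := h z y₁ y₂ a h₁ h₂ h₁a h₂a
    have key : ∀ x, z < x → x ≤ a → rk a - rk x < rk a - rk z := fun x hx hxa => by
      have h1 := hrk hx
      have h2 := hrk.monotone hxa
      omega
    have hqa : q ≤ a := hq.2 (by
      rintro _ (rfl | rfl)
      exacts [hxy₁.trans h₁a, hxy₂.trans h₂a])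
    have hxq₁ : x₁ ≤ q := hq.1 (by simp)
    have hxq₂ : x₂ ≤ q := hq.1 (by simp)
    -- the join is built as `(y₁ ⊔ q) ⊔ y₂`, first above `x₁` and then above `x₂`
    obtain ⟨p, hp, hpC⟩ := ih _ (key x₁ hx₁ (hxy₁.trans h₁a)) hxy₁ hxq₁ h₁a hqa rfl
    have hpa : p ≤ a := hp.2 (by rintro _ (rfl | rfl) <;> assumption)
    have hyp : y₁ ≤ p := hp.1 (by simp)
    have hqp : q ≤ p := hp.1 (by simp)
    obtain ⟨j, hj, hjC⟩ := ih _ (key x₂ hx₂ (hxy₂.trans h₂a)) (hxq₂.trans hqp) hxy₂ hpa h₂a rfl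
    have hpj : p ≤ j := hj.1 (by simp)
    refine ⟨j, ⟨?_, fun b hb => hj.2 ?_⟩, fun c₁ c₂ => ?_⟩
    · rintro _ (rfl | rfl)
      exacts [hyp.trans hpj, hj.1 (by simp)]
    · have hb₁ : y₁ ≤ b := hb (by simp)
      have hb₂ : y₂ ≤ b := hb (by simp)
      have hqb : q ≤ b := hq.2 (by
        rintro _ (rfl | rfl)
        exacts [hxy₁.trans hb₁, hxy₂.trans hb₂])
      have hpb : p ≤ b := hp.2 (by rintro _ (rfl | rfl) <;> assumption)
      rintro _ (rfl | rfl) <;> assumption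
    · exact hjC (hpC c₁ (hqC (hC hxy₁ c₁) (hC hxy₂ c₂))) c₂

/-- A bounded directed set in a graded poset has a greatest element: any element of largest rank. -/
theorem exists_isGreatest_of_rank {D : Set α} (hrk : StrictMono rk) (hD : D.Nonempty) {b₀ : α}
    (hb₀ : b₀ ∈ upperBounds D)
    (h : ∀ x ∈ D, ∀ y ∈ D, ∃ j ∈ D, x ≤ j ∧ y ≤ j) : ∃ m, IsGreatest D m := by
  obtain ⟨m, hm, hmax⟩ := Nat.sSup_mem (s := rk '' D) (hD.image _)
    ⟨rk b₀, by rintro _ ⟨y, hy, rfl⟩; exact hrk.monotone (hb₀ hy)⟩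
  refine ⟨m, hm, fun y hy => ?_⟩
  obtain ⟨j, hj, hmj, hyj⟩ := h m hm y hy
  rcases hmj.eq_or_lt with rfl | hlt
  · exact hyj
  · have h1 : rk j ≤ sSup (rk '' D) := le_csSup
      ⟨rk b₀, by rintro _ ⟨y, hy, rfl⟩; exact hrk.monotone (hb₀ hy)⟩ ⟨j, hj, rfl⟩
    have h2 := hrk hlt
    omega

theorem isCompleteMeetSemilattice_of_bounded_pairs (hrk : StrictMono rk) {o : α} (ho : IsBot o)
    (h : ∀ y₁ y₂ a : α, y₁ ≤ a → y₂ ≤ a → ∃ j, IsLUB {y₁, y₂} j) :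
    IsCompleteMeetSemilattice α := by
  rintro s ⟨a, ha⟩
  refine exists_isGreatest_of_rank hrk ⟨o, fun x _ => ho x⟩ (b₀ := a) (fun y hy => hy ha) ?_
  intro x hx y hy
  obtain ⟨j, hj⟩ := h x y a (hx ha) (hy ha)
  refine ⟨j, fun b hb => hj.2 ?_, hj.1 (by simp), hj.1 (by simp)⟩
  rintro _ (rfl | rfl)
  exacts [hx hb, hy hb]

theorem isJoinClosed_of_bounded_pairs (hrk : StrictMono rk) {o : α} (ho : IsBot o)
    (hoC : o ∈ C) (h : ∀ y₁ ∈ C, ∀ y₂ ∈ C, ∀ a, y₁ ≤ a → y₂ ≤ a → ∃ j ∈ C, IsLUB {y₁, y₂} j) :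
    IsJoinClosed C := by
  intro X hX j hj
  obtain ⟨m, hm, hmax⟩ := exists_isGreatest_of_rank (D := C ∩ Set.Iic j) hrk ⟨o, hoC, ho j⟩
    (b₀ := j) (fun _ hy => hy.2) (by
      rintro x ⟨hx, hxj⟩ y ⟨hy, hyj⟩
      obtain ⟨k, hk, hlub⟩ := h x hx y hy j hxj hyj
      exact ⟨k, ⟨hk, hlub.2 (by rintro _ (rfl | rfl) <;> assumption)⟩, hlub.1 (by simp),
        hlub.1 (by simp)⟩)
  have : m = j := le_antisymm hm.2 (hj.2 fun x hx => hmax ⟨hX hx, hj.1 hx⟩)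
  exact this ▸ hm.1

end Posets

/-! ### The exchange property of Coxeter groups -/

namespace CoxeterSystem

variable {B : Type u} {W : Type v} [Group W] {M : CoxeterMatrix B} (cs : CoxeterSystem M W)

open Classical in
/-- The action of a simple reflection on pairs of an element of `W` and a sign: conjugation of the
element, and change of sign exactly if the element is the simple reflection itself. -/
noncomputable def signedConj (i : B) : Function.End (W × ZMod 2) :=
  fun p => (cs.simple i * p.1 * cs.simple i, p.2 + if p.1 = cs.simple i then 1 else 0)

open Classical in
theorem signedConj_mul_pow (i i' : B) (n : ℕ) (t : W) (ε : ZMod 2) :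
    ((cs.signedConj i * cs.signedConj i') ^ n : Function.End (W × ZMod 2)) (t, ε) =
      ((cs.simple i * cs.simple i') ^ n * t * ((cs.simple i * cs.simple i') ^ n)⁻¹,
        ε + ∑ j ∈ Finset.range (2 * n),
          if (cs.simple i * cs.simple i') ^ j * t = cs.simple i' then 1 else 0) := by
  induction n with
  | zero => simp; rfl
  | succ n ih =>
    set s := cs.simple i with hs
    set s' := cs.simple i' with hs'
    have hss : s * s = 1 := cs.simple_mul_simple_self i
    have hss' : s' * s' = 1 := cs.simple_mul_simple_self i'
    have hsi : s⁻¹ = s := cs.inv_simple i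
    have hsi' : s'⁻¹ = s' := cs.inv_simple i'
    set r := s * s' with hr
    have hri : r⁻¹ = s' * s := by rw [hr, mul_inv_rev, hsi, hsi']
    -- `s'` inverts the rotation `r`
    have hconj : s' * r ^ n * s' = (r ^ n)⁻¹ := by
      have h1 : s' * r * s'⁻¹ = r⁻¹ := by
        rw [hri, hr, hsi']
        simp only [mul_assoc, hss', mul_one]
      rw [← inv_pow, ← h1, conj_pow, hsi']
    have hn : s' * r ^ n = (r ^ n)⁻¹ * s' := by
      rw [← hconj]; simp only [mul_assoc, hss', mul_one]
    have e1 : r ^ n * t * (r ^ n)⁻¹ = s' ↔ r ^ (2 * n) * t = s' := by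
      rw [two_mul, pow_add, mul_inv_eq_iff_eq_mul, hn, mul_assoc, eq_inv_mul_iff_mul_eq]
    have e2 : s' * (r ^ n * t * (r ^ n)⁻¹) * s' = s ↔ r ^ (2 * n + 1) * t = s' := by
      have h1 : s' * (r ^ n * t * (r ^ n)⁻¹) * s' = s ↔ r * (r ^ n * t * (r ^ n)⁻¹) = s' := by
        rw [← mul_right_inj s, ← mul_left_inj s', hss]
        simp only [mul_assoc, hss', mul_one, one_mul, hr]
      have h2 : r * (r ^ n * t * (r ^ n)⁻¹) = r ^ (n + 1) * t * (r ^ n)⁻¹ := by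
        rw [pow_succ']; simp only [mul_assoc]
      rw [h1, h2, mul_inv_eq_iff_eq_mul, hn, eq_inv_mul_iff_mul_eq, ← mul_assoc, ← pow_add,
        two_mul, add_assoc]
    rw [pow_succ']
    change cs.signedConj i (cs.signedConj i' (((cs.signedConj i * cs.signedConj i') ^ n :
      Function.End (W × ZMod 2)) (t, ε))) = _
    rw [ih]
    simp only [signedConj, ← hs, ← hs', e1, e2]
    rw [mul_add, mul_one, Finset.sum_range_succ, Finset.sum_range_succ]
    refine Prod.ext ?_ ?_
    · simp only [pow_succ', mul_inv_rev, hr, hsi, hsi', mul_assoc]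
    · simp only [add_assoc]

theorem isLiftable_signedConj : M.IsLiftable cs.signedConj := by
  classical
  intro i i'
  funext ⟨t, ε⟩
  rw [signedConj_mul_pow, cs.simple_mul_simple_pow, two_mul, Finset.sum_range_add]
  simp only [pow_add, cs.simple_mul_simple_pow, one_mul, mul_one, inv_one]
  rw [CharTwo.add_self_eq_zero, add_zero]
  rfl

/-- The action of `W` on pairs of an element of `W` and a sign by conjugation and sign change. -/
noncomputable def signedConjHom : W →* Function.End (W × ZMod 2) :=
  cs.lift ⟨cs.signedConj, cs.isLiftable_signedConj⟩

open Classical in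
/-- The sign change at `t` is the parity of the number of occurrences of `t` in the right inversion
sequence of any word for the acting element. -/
theorem signedConjHom_wordProd (ω : List B) (t : W) (ε : ZMod 2) :
    cs.signedConjHom (cs.wordProd ω) (t, ε) =
      (cs.wordProd ω * t * (cs.wordProd ω)⁻¹, ε + ((cs.rightInvSeq ω).count t : ℕ)) := by
  induction ω with
  | nil =>
    rw [wordProd_nil, map_one]
    simp
    rfl
  | cons i ω ih =>
    rw [wordProd_cons, map_mul]
    change cs.signedConjHom (cs.simple i) (cs.signedConjHom (cs.wordProd ω) (t, ε)) = _
    rw [ih, signedConjHom, lift_apply_simple]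
    have h : cs.wordProd ω * t * (cs.wordProd ω)⁻¹ = cs.simple i ↔
        (cs.wordProd ω)⁻¹ * cs.simple i * cs.wordProd ω = t := by
      rw [mul_inv_eq_iff_eq_mul, mul_assoc, inv_mul_eq_iff_eq_mul, eq_comm]
    simp only [signedConj, rightInvSeq, List.count_cons, h, beq_iff_eq]
    refine Prod.ext ?_ ?_
    · simp only [mul_inv_rev, inv_simple, mul_assoc]
    · push_cast
      rw [add_assoc]

/-- A right descent occurs in the right inversion sequence of every word. -/
theorem simple_mem_rightInvSeq {ω : List B} {i : B} (h : cs.IsRightDescent (cs.wordProd ω) i) :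
    cs.simple i ∈ cs.rightInvSeq ω := by
  classical
  by_contra hmem
  obtain ⟨ω', hω', hw⟩ := cs.exists_isReduced (cs.wordProd ω * cs.simple i)
  -- acting by `w = (w s) s` in two steps, the signs at `s` differ by one
  have h1 := cs.signedConjHom_wordProd ω (cs.simple i) 0
  rw [List.count_eq_zero_of_not_mem hmem] at h1
  have h2 : cs.signedConjHom (cs.wordProd ω) (cs.simple i, 0) =
      cs.signedConjHom (cs.wordProd ω') (cs.signedConjHom (cs.simple i) (cs.simple i, 0)) := by
    change _ = (cs.signedConjHom (cs.wordProd ω') * cs.signedConjHom (cs.simple i)) _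
    rw [← map_mul, ← hw, mul_assoc, cs.simple_mul_simple_self, mul_one]
  have h3 : cs.signedConjHom (cs.simple i) (cs.simple i, 0) = (cs.simple i, 1) := by
    rw [signedConjHom, lift_apply_simple]
    simp [signedConj]
  rw [h3, h1, signedConjHom_wordProd] at h2
  have h4 : cs.simple i ∈ cs.rightInvSeq ω' := by
    by_contra hmem'
    rw [List.count_eq_zero_of_not_mem hmem'] at h2
    simpa using congrArg Prod.snd h2
  have h5 := (cs.isRightInversion_of_mem_rightInvSeq hω' h4).2
  rw [← hw, mul_assoc, cs.simple_mul_simple_self, mul_one] at h5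
  exact absurd h (by unfold IsRightDescent; omega)

/-- The exchange property: multiplication by a left descent deletes a letter of any given word. -/
theorem exists_simple_mul_eq_wordProd_eraseIdx {ω : List B} {i : B}
    (h : cs.IsLeftDescent (cs.wordProd ω) i) :
    ∃ k < ω.length, cs.simple i * cs.wordProd ω = cs.wordProd (ω.eraseIdx k) := by
  have h1 : cs.simple i ∈ cs.leftInvSeq ω := by
    rw [← List.mem_reverse, ← rightInvSeq_reverse]
    refine cs.simple_mem_rightInvSeq ?_
    rwa [wordProd_reverse, isRightDescent_inv_iff]
  obtain ⟨k, hk, hk'⟩ := List.mem_iff_getElem.mp h1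
  refine ⟨k, by simpa using hk, ?_⟩
  rw [← getD_leftInvSeq_mul_wordProd, List.getD_eq_getElem _ _ hk, hk']

end CoxeterSystem

/-! ### Parabolic subgroups and the weak order -/

namespace CoxeterSystem

variable {B : Type u} {W : Type v} [Group W] {M : CoxeterMatrix B} (cs : CoxeterSystem M W)

theorem simple_weakRightLE_iff {a : W} {i : B} :
    CoxeterWeakRightLE cs (cs.simple i) a ↔ cs.IsLeftDescent a i := by
  rw [isLeftDescent_iff, CoxeterWeakRightLE, length_simple, inv_simple, add_comm, eq_comm]

theorem weakRightLE_mul_iff {x b : W} :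
    CoxeterWeakRightLE cs x (x * b) ↔ cs.length (x * b) = cs.length x + cs.length b := by
  rw [CoxeterWeakRightLE, inv_mul_cancel_left]

theorem weakRightLE_trans {x y z : W} (hxy : CoxeterWeakRightLE cs x y)
    (hyz : CoxeterWeakRightLE cs y z) : CoxeterWeakRightLE cs x z :=
  (inferInstance : PartialOrder (CoxeterWeakRight cs)).le_trans x y z hxy hyz

/-- Left translation identifies the weak order above `z` with a part of the weak order. -/
theorem weakRightLE_mul_of_le {z y c : W} (hz : CoxeterWeakRightLE cs z y)
    (hc : CoxeterWeakRightLE cs c (z⁻¹ * y)) :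
    CoxeterWeakRightLE cs z (z * c) ∧ CoxeterWeakRightLE cs (z * c) y := by
  have h1 := cs.length_mul_le z c
  have h2 := cs.length_mul_le (z * c) ((z * c)⁻¹ * y)
  rw [mul_inv_cancel_left] at h2
  simp only [CoxeterWeakRightLE, mul_inv_rev, mul_assoc, inv_mul_cancel_left] at *
  omega

theorem weakRightLE_inv_mul {z y c : W} (hz : CoxeterWeakRightLE cs z (z * c))
    (hc : CoxeterWeakRightLE cs (z * c) y) : CoxeterWeakRightLE cs c (z⁻¹ * y) := by
  have h := cs.weakRightLE_trans hz hc
  simp only [CoxeterWeakRightLE, mul_inv_rev, mul_assoc, inv_mul_cancel_left] at *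
  omega

/-- The exchange property in terms of the weak order. -/
theorem simple_mul_weakRightLE {p a : W} {i : B} (hp : CoxeterWeakRightLE cs p a)
    (hi : cs.IsLeftDescent a i) (hip : ¬ cs.IsLeftDescent p i) :
    CoxeterWeakRightLE cs (cs.simple i * p) a := by
  obtain ⟨ω₁, h₁, rfl⟩ := cs.exists_isReduced p
  obtain ⟨ω₂, h₂, hb⟩ := cs.exists_isReduced ((cs.wordProd ω₁)⁻¹ * a)
  obtain rfl : a = cs.wordProd (ω₁ ++ ω₂) := by
    rw [wordProd_append, ← hb, mul_inv_cancel_left]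
  rw [CoxeterWeakRightLE, hb, h₁.eq, h₂.eq] at hp
  have hip' := cs.not_isLeftDescent_iff.mp hip
  rw [h₁.eq] at hip'
  obtain ⟨k, hk, hk'⟩ := cs.exists_simple_mul_eq_wordProd_eraseIdx hi
  rw [List.length_append] at hk
  rcases lt_or_ge k ω₁.length with hk₁ | hk₁
  · -- a letter of `p` cannot be deleted, since `i` is not a descent of `p`
    rw [List.eraseIdx_append_of_lt_length hk₁, wordProd_append, wordProd_append, ← mul_assoc,
      mul_left_inj] at hk'
    have h3 := cs.length_wordProd_le (ω₁.eraseIdx k)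
    rw [← hk', List.length_eraseIdx_of_lt hk₁] at h3
    omega
  · rw [List.eraseIdx_append_of_length_le hk₁, wordProd_append (ω' := ω₂.eraseIdx _)] at hk'
    have h3 := cs.length_wordProd_le (ω₂.eraseIdx (k - ω₁.length))
    rw [List.length_eraseIdx_of_lt (by omega)] at h3
    have h4 := cs.length_mul_le (cs.simple i * cs.wordProd ω₁)
      ((cs.simple i * cs.wordProd ω₁)⁻¹ * cs.wordProd (ω₁ ++ ω₂))
    rw [mul_inv_cancel_left] at h4
    have h5 : (cs.simple i * cs.wordProd ω₁)⁻¹ * cs.wordProd (ω₁ ++ ω₂) =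
        cs.wordProd (ω₂.eraseIdx (k - ω₁.length)) := by
      rw [mul_inv_rev, inv_simple, mul_assoc, hk', inv_mul_cancel_left]
    rw [CoxeterWeakRightLE]
    rw [h5] at h4 ⊢
    omega

/-- The standard parabolic subgroup generated by the simple reflections in `J`. -/
def parabolic (J : Set B) : Subgroup W := Subgroup.closure (cs.simple '' J)

variable {J : Set B}

theorem simple_mem_parabolic {i : B} (hi : i ∈ J) : cs.simple i ∈ cs.parabolic J :=
  Subgroup.subset_closure ⟨i, hi, rfl⟩

theorem exists_isReduced_of_mem_parabolic {w : W} (hw : w ∈ cs.parabolic J) :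
    ∃ ω : List B, cs.IsReduced ω ∧ (∀ i ∈ ω, i ∈ J) ∧ w = cs.wordProd ω := by
  have key : ∀ i ∈ J, ∀ y, (∃ ω : List B, cs.IsReduced ω ∧ (∀ i ∈ ω, i ∈ J) ∧
      y = cs.wordProd ω) → ∃ ω : List B, cs.IsReduced ω ∧ (∀ i ∈ ω, i ∈ J) ∧
      cs.simple i * y = cs.wordProd ω := by
    rintro i hi _ ⟨ω, hω, hJ, rfl⟩
    by_cases hd : cs.IsLeftDescent (cs.wordProd ω) i
    · obtain ⟨k, hk, hk'⟩ := cs.exists_simple_mul_eq_wordProd_eraseIdx hd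
      refine ⟨ω.eraseIdx k, ?_, fun j hj => hJ j ((List.eraseIdx_sublist ω k).subset hj), hk'⟩
      have h1 := cs.isLeftDescent_iff.mp hd
      rw [hω.eq] at h1
      rw [IsReduced, ← hk', List.length_eraseIdx_of_lt hk]
      omega
    · refine ⟨i :: ω, ?_, ?_, (cs.wordProd_cons i ω).symm⟩
      · rw [IsReduced, wordProd_cons, cs.not_isLeftDescent_iff.mp hd, hω.eq, List.length_cons]
      · rintro j hj
        rcases List.mem_cons.mp hj with rfl | hj
        exacts [hi, hJ j hj]
  induction hw using Subgroup.closure_induction_left with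
  | one => exact ⟨[], by simp [IsReduced], by simp, by simp⟩
  | mul_left x hx y _ ih =>
    obtain ⟨i, hi, rfl⟩ := hx
    exact key i hi y ih
  | inv_mul_cancel x hx y _ ih =>
    obtain ⟨i, hi, rfl⟩ := hx
    rw [inv_simple]
    exact key i hi y ih

/-- If all simple reflections in `J` are left descents of `a`, then the whole parabolic subgroup
lies below `a` in the weak order. -/
theorem weakRightLE_of_mem_parabolic {a w : W} (ha : ∀ i ∈ J, cs.IsLeftDescent a i)
    (hw : w ∈ cs.parabolic J) : CoxeterWeakRightLE cs w a := by
  obtain ⟨ω, hω, hJ, rfl⟩ := cs.exists_isReduced_of_mem_parabolic hw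
  clear hw
  induction ω with
  | nil => simp [CoxeterWeakRightLE]
  | cons i ω ih =>
    have hω' : cs.IsReduced ω := by simpa using hω.drop 1
    rw [wordProd_cons]
    refine cs.simple_mul_weakRightLE (ih hω' fun j hj => hJ j (List.mem_cons_of_mem i hj))
      (ha i (hJ i List.mem_cons_self)) ?_
    rw [not_isLeftDescent_iff, ← wordProd_cons, hω.eq, hω'.eq, List.length_cons]

/-- If a parabolic subgroup has bounded lengths and `v` has no right descent in `J`, then `v` is
the shortest element of its coset, and lengths add. -/
theorem length_mul_of_mem_parabolic {v u : W} {n : ℕ} (hn : ∀ w ∈ cs.parabolic J, cs.length w ≤ n)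
    (hv : ∀ i ∈ J, ¬ cs.IsRightDescent v i) (hu : u ∈ cs.parabolic J) :
    cs.length (v * u) = cs.length v + cs.length u := by
  -- a longest element `b = v * w` of the coset
  have hbdd : BddAbove ((fun w => cs.length (v * w)) '' (cs.parabolic J : Set W)) := by
    refine ⟨cs.length v + n, ?_⟩
    rintro _ ⟨w, hw, rfl⟩
    exact (cs.length_mul_le v w).trans (Nat.add_le_add_left (hn w hw) _)
  obtain ⟨w, hw, hmax⟩ := Nat.sSup_mem (Set.Nonempty.image _ ⟨1, one_mem (cs.parabolic J)⟩) hbdd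
  have hmax' : ∀ w' ∈ cs.parabolic J, cs.length (v * w') ≤ cs.length (v * w) := fun w' hw' =>
    (le_csSup hbdd ⟨w', hw', rfl⟩).trans hmax.ge
  have hb : ∀ i ∈ J, cs.IsLeftDescent (v * w)⁻¹ i := fun i hi => by
    rw [isLeftDescent_inv_iff]
    by_contra h
    rw [not_isRightDescent_iff, mul_assoc] at h
    have := hmax' _ (mul_mem hw (cs.simple_mem_parabolic hi))
    omega
  have hlen : ∀ x ∈ cs.parabolic J, cs.length (v * w) = cs.length (v * w * x) + cs.length x := by
    intro x hx
    have h := cs.weakRightLE_of_mem_parabolic hb hx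
    rw [CoxeterWeakRightLE, length_inv, ← mul_inv_rev, length_inv] at h
    omega
  have h1 := hlen w⁻¹ (inv_mem hw)
  rw [mul_inv_cancel_right, length_inv] at h1
  -- `w` is the longest element of the parabolic subgroup
  have hwJ : ∀ i ∈ J, cs.IsLeftDescent w i := fun i hi => by
    have h2 := hlen (w⁻¹ * cs.simple i) (mul_mem (inv_mem hw) (cs.simple_mem_parabolic hi))
    have h3 := cs.not_isRightDescent_iff.mp (hv i hi)
    rw [← mul_assoc, mul_inv_cancel_right, ← cs.length_inv (w⁻¹ * _), mul_inv_rev, inv_inv,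
      inv_simple] at h2
    rw [IsLeftDescent]
    omega
  have h4 := cs.weakRightLE_of_mem_parabolic hwJ hu
  have h5 := hlen (w⁻¹ * u) (mul_mem (inv_mem hw) hu)
  rw [← mul_assoc, mul_inv_cancel_right, ← cs.length_inv (w⁻¹ * _), mul_inv_rev, inv_inv] at h5
  rw [CoxeterWeakRightLE] at h4
  omega

/-! ### The weak order as a semilattice with orthogonality relation -/

/-- The relation `ℓ(x⁻¹ y) = ℓ(x) + ℓ(y)`; equivalently, `x` and `y` have no common left
inversion. -/
def WeakRightOrthogonal (x y : W) : Prop := cs.length (x⁻¹ * y) = cs.length x + cs.length y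

theorem weakRightOrthogonal_one (x : W) : cs.WeakRightOrthogonal x 1 := by
  rw [WeakRightOrthogonal, mul_one, length_inv, length_one, add_zero]

theorem WeakRightOrthogonal.symm {x y : W} (h : cs.WeakRightOrthogonal x y) :
    cs.WeakRightOrthogonal y x := by
  rw [WeakRightOrthogonal, ← length_inv, mul_inv_rev, inv_inv, h, add_comm]

theorem WeakRightOrthogonal.mono {x y z : W} (h : cs.WeakRightOrthogonal x y)
    (hz : CoxeterWeakRightLE cs z y) : cs.WeakRightOrthogonal x z := by
  have h1 := cs.length_mul_le (x⁻¹ * z) (z⁻¹ * y)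
  have h2 := cs.length_mul_le x⁻¹ z
  rw [mul_assoc, mul_inv_cancel_left] at h1
  simp only [WeakRightOrthogonal, CoxeterWeakRightLE, length_inv] at *
  omega

theorem exists_isLeftDescent_of_ne {z y : W} (hzy : z ≠ y) :
    ∃ i, cs.IsLeftDescent (z⁻¹ * y) i :=
  cs.exists_leftDescent_of_ne_one fun h => hzy (inv_mul_eq_one.mp h)

theorem weakRightLE_mul_simple {z y : W} {i : B} (h : CoxeterWeakRightLE cs z y)
    (hi : cs.IsLeftDescent (z⁻¹ * y) i) : CoxeterWeakRightLE cs z (z * cs.simple i) ∧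
      CoxeterWeakRightLE cs (z * cs.simple i) y :=
  cs.weakRightLE_mul_of_le h (cs.simple_weakRightLE_iff.mpr hi)

/-- Two elements `z s`, `z s'` covering `z` with a common upper bound have a join `z w`, where `w`
is the longest element of the finite parabolic subgroup generated by `s` and `s'`. The join is
orthogonal to whatever `z s` and `z s'` are orthogonal to. -/
theorem exists_join_mul_simple {z a : W} {i i' : B}
    (hz : CoxeterWeakRightLE cs z a) (hi : cs.IsLeftDescent (z⁻¹ * a) i)
    (hi' : cs.IsLeftDescent (z⁻¹ * a) i') :
    ∃ q, CoxeterWeakRightLE cs (z * cs.simple i) q ∧ CoxeterWeakRightLE cs (z * cs.simple i') q ∧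
      (∀ b, CoxeterWeakRightLE cs (z * cs.simple i) b → CoxeterWeakRightLE cs (z * cs.simple i') b →
        CoxeterWeakRightLE cs q b) ∧
      ∀ x, cs.WeakRightOrthogonal x (z * cs.simple i) →
        cs.WeakRightOrthogonal x (z * cs.simple i') → cs.WeakRightOrthogonal x q := by
  set J : Set B := {i, i'} with hJ
  have hJa : ∀ k ∈ J, cs.IsLeftDescent (z⁻¹ * a) k := by rintro k (rfl | rfl) <;> assumption
  have hle : ∀ w ∈ cs.parabolic J, CoxeterWeakRightLE cs w (z⁻¹ * a) := fun w hw =>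
    cs.weakRightLE_of_mem_parabolic hJa hw
  have hn : ∀ w ∈ cs.parabolic J, cs.length w ≤ cs.length (z⁻¹ * a) := fun w hw => by
    rw [hle w hw]
    omega
  have hbdd : BddAbove (cs.length '' (cs.parabolic J : Set W)) :=
    ⟨_, by rintro _ ⟨w, hw, rfl⟩; exact hn w hw⟩
  obtain ⟨w, hw, hmax⟩ := Nat.sSup_mem (Set.Nonempty.image _ ⟨1, one_mem (cs.parabolic J)⟩) hbdd
  have hwJ : ∀ k ∈ J, cs.IsLeftDescent w k := fun k hk => by
    by_contra h
    rw [not_isLeftDescent_iff] at h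
    have := le_csSup hbdd ⟨_, mul_mem (cs.simple_mem_parabolic hk) hw, rfl⟩
    omega
  have hzw := cs.weakRightLE_mul_of_le hz (hle w hw)
  have hzk : ∀ k ∈ J, CoxeterWeakRightLE cs z (z * cs.simple k) := fun k hk =>
    (cs.weakRightLE_mul_simple hz (hJa k hk)).1
  have hkw : ∀ k ∈ J, CoxeterWeakRightLE cs (z * cs.simple k) (z * w) := fun k hk =>
    (cs.weakRightLE_mul_simple hzw.1 (by rw [inv_mul_cancel_left]; exact hwJ k hk)).2
  have hiJ : i ∈ J := by simp [hJ]
  have hiJ' : i' ∈ J := by simp [hJ]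
  refine ⟨z * w, hkw i hiJ, hkw i' hiJ', fun b hb hb' => ?_, fun x hx hx' => ?_⟩
  · refine (cs.weakRightLE_mul_of_le (cs.weakRightLE_trans (hzk i hiJ) hb)
      (cs.weakRightLE_of_mem_parabolic (J := J) ?_ hw)).2
    rintro k (rfl | rfl)
    · exact cs.simple_weakRightLE_iff.mp (cs.weakRightLE_inv_mul (hzk _ hiJ) hb)
    · exact cs.simple_weakRightLE_iff.mp (cs.weakRightLE_inv_mul (hzk _ hiJ') hb')
  · have hxz : cs.WeakRightOrthogonal x z := hx.mono cs (hzk i hiJ)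
    have hxJ : ∀ k ∈ J, cs.WeakRightOrthogonal x (z * cs.simple k) := by
      rintro k (rfl | rfl) <;> assumption
    have h := cs.length_mul_of_mem_parabolic (v := x⁻¹ * z) hn (fun k hk => by
      have h1 := cs.weakRightLE_mul_iff.mp (hzk k hk)
      have h2 := hxJ k hk
      rw [WeakRightOrthogonal] at hxz h2
      rw [not_isRightDescent_iff, hxz, mul_assoc, h2, h1, length_simple, add_assoc]) hw
    rw [WeakRightOrthogonal] at hxz ⊢
    rw [← mul_assoc, h, hxz, cs.weakRightLE_mul_iff.mp hzw.1, add_assoc]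

theorem strictMono_length :
    StrictMono (α := CoxeterWeakRight cs) (β := ℕ) fun x => @length B W _ M cs x := by
  intro (x : W) (y : W) hxy
  change cs.length x < cs.length y
  have h : cs.length y = cs.length x + cs.length (x⁻¹ * y) := hxy.le
  have h0 : cs.length (x⁻¹ * y) ≠ 0 := fun h0 =>
    hxy.ne ((@inv_mul_eq_one W _ x y).mp (cs.length_eq_zero_iff.mp h0))
  omega

theorem isBot_one : IsBot (α := CoxeterWeakRight cs) (1 : W) := fun (x : W) => by
  change CoxeterWeakRightLE cs 1 x
  simp [CoxeterWeakRightLE]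

/-- Bounded pairs have joins in the weak order, and these joins preserve orthogonality. -/
theorem exists_isLUB_pair (x : W) (y₁ y₂ a : CoxeterWeakRight cs) (h₁ : y₁ ≤ a) (h₂ : y₂ ≤ a) :
    ∃ j : CoxeterWeakRight cs, IsLUB {y₁, y₂} j ∧ (cs.WeakRightOrthogonal x y₁ →
      cs.WeakRightOrthogonal x y₂ → cs.WeakRightOrthogonal x j) := by
  refine exists_isLUB_pair_of_local (α := CoxeterWeakRight cs)
    (C := {y | cs.WeakRightOrthogonal x y}) cs.strictMono_length
    (fun y z hzy (hy : cs.WeakRightOrthogonal x y) => hy.mono cs hzy) ?_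
    (cs.isBot_one y₁) (cs.isBot_one y₂) h₁ h₂
  intro (z : W) (y₁ : W) (y₂ : W) (a : W) hz₁ hz₂ h₁a h₂a
  have lt_mul_simple : ∀ (z y : W) (i : B), CoxeterWeakRightLE cs z y →
      cs.IsLeftDescent (z⁻¹ * y) i →
      (show CoxeterWeakRight cs from z) < (show CoxeterWeakRight cs from z * cs.simple i) :=
    fun z y i h hi => lt_of_le_of_ne (cs.weakRightLE_mul_simple h hi).1 fun he => by
      have h1 := congrArg cs.length (left_eq_mul.mp (show z = z * cs.simple i from he))
      rw [length_simple, length_one] at h1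
      omega
  obtain ⟨i, hi⟩ := cs.exists_isLeftDescent_of_ne hz₁.ne
  obtain ⟨i', hi'⟩ := cs.exists_isLeftDescent_of_ne hz₂.ne
  have key : ∀ (z y a : W) (i : B), CoxeterWeakRightLE cs z y → CoxeterWeakRightLE cs y a →
      cs.IsLeftDescent (z⁻¹ * y) i → cs.IsLeftDescent (z⁻¹ * a) i := fun z y a i h ha hi =>
    cs.simple_weakRightLE_iff.mp (cs.weakRightLE_inv_mul (cs.weakRightLE_mul_simple h hi).1
      (cs.weakRightLE_trans (cs.weakRightLE_mul_simple h hi).2 ha))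
  obtain ⟨q, hq, hq', hqb, hqx⟩ := cs.exists_join_mul_simple (z := z) (a := a)
    (hz₁.le.trans h₁a) (key z y₁ a i hz₁.le h₁a hi) (key z y₂ a i' hz₂.le h₂a hi')
  refine ⟨_, _, q, lt_mul_simple z y₁ i hz₁.le hi, (cs.weakRightLE_mul_simple hz₁.le hi).2,
    lt_mul_simple z y₂ i' hz₂.le hi', (cs.weakRightLE_mul_simple hz₂.le hi').2, ⟨?_, ?_⟩, hqx x⟩
  · rintro _ (rfl | rfl)
    exacts [hq, hq']
  · exact fun b hb => hqb b (hb (Set.mem_insert _ _)) (hb (Set.mem_insert_of_mem _ rfl))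

theorem isCompleteMeetSemilattice_weakRight :
    IsCompleteMeetSemilattice (CoxeterWeakRight cs) :=
  isCompleteMeetSemilattice_of_bounded_pairs cs.strictMono_length cs.isBot_one
    fun y₁ y₂ a h₁ h₂ => (cs.exists_isLUB_pair 1 y₁ y₂ a h₁ h₂).imp fun _ h => h.1

theorem isOrthogonalityRelation_weakRight : IsOrthogonalityRelation (L := CoxeterWeakRight cs)
    fun x y => cs.WeakRightOrthogonal x y where
  symm _ _ h := h.symm cs
  nonempty x := ⟨(1 : W), cs.weakRightOrthogonal_one x⟩
  isLowerSet x y z hzy hy := WeakRightOrthogonal.mono cs hy hzy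
  isJoinClosed x := isJoinClosed_of_bounded_pairs cs.strictMono_length cs.isBot_one
    (cs.weakRightOrthogonal_one x)
    fun y₁ hy₁ y₂ hy₂ a h₁ h₂ => by
      obtain ⟨j, hj, hjx⟩ := cs.exists_isLUB_pair x y₁ y₂ a h₁ h₂
      exact ⟨j, hjx hy₁ hy₂, hj⟩
  isBot_of_self (a : W) h := by
    have h' : cs.length (a⁻¹ * a) = cs.length a + cs.length a := h
    rw [inv_mul_cancel, length_one] at h'
    obtain rfl : a = 1 := cs.length_eq_zero_iff.mp (by omega)
    exact cs.isBot_one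

end CoxeterSystem

/-! ### Embeddings in complete ortholattices -/

/-- Embeddings of semilattices with orthogonality relation, of standard protomeshes, of rootoids and
of Coxeter systems in complete ortholattices. In the first part, the ortholattice and the
isomorphism onto an order ideal are canonically associated to the semilattice with its orthogonality
relation: they are functorial for isomorphisms. -/
theorem corollary10p8 :
    (∃ (V : OrthogonalitySemilattice.{u} → Type u)
        (_ : ∀ A, CompleteOrtholattice (V A))
        (I : ∀ A, LowerSet (V A))
        (i : ∀ A : OrthogonalitySemilattice.{u}, A.carrier ≃o I A)
        (φ : ∀ A B : OrthogonalitySemilattice.{u}, A.Iso B → (V A ≃o V B)),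
      (∀ A B (e : A.Iso B) (z : V A), φ A B e zᶜ = (φ A B e z)ᶜ) ∧
      (∀ A (z : V A), φ A A (OrthogonalitySemilattice.Iso.refl A) z = z) ∧
      (∀ A B C (e : A.Iso B) (f : B.Iso C) (z : V A), φ A C (e.trans f) z = φ B C f (φ A B e z)) ∧
      (∀ A B (e : A.Iso B) (x : A.carrier),
        φ A B e (i A x : V A) = (i B (e.toOrderIso x) : V B))) ∧
    (∀ (R : Type u) [BooleanRng R] (L : Set R), (0 : R) ∈ L → IsCompleteMeetSemilattice L →
      SatisfiesJOP L → IsIdealOfCompleteOrtholattice L) ∧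
    (∀ (G : Type u) [Groupoid.{v} G] (R : Protorootoid.{u, v, w} G), R.IsRootoid →
      ∀ a : G, IsIdealOfCompleteOrtholattice (R.WeakRight a)) ∧
    (∀ (B : Type u) (W : Type v) [Group W] (M : CoxeterMatrix B) (cs : CoxeterSystem M W),
      IsIdealOfCompleteOrtholattice (CoxeterWeakRight cs)) := by
  refine ⟨⟨fun A => A.Ortholattice, fun _ => inferInstance,
      fun A => IsOrthogonalityRelation.principalConcepts A.isCompleteMeetSemilattice
        A.isOrthogonalityRelation,
      fun A => IsOrthogonalityRelation.orderIsoPrincipalConcepts A.isCompleteMeetSemilattice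
        A.isOrthogonalityRelation,
      fun _ _ e => e.ortholattice, fun _ _ _ _ => rfl, fun _ z => ?_, fun _ _ _ _ _ z => ?_,
      fun _ _ e x => e.ortholattice_ofObject x⟩, ?_, ?_, ?_⟩
  · exact Concept.ext (by ext (y | y) <;> rfl)
  · exact Concept.ext (by ext (y | y) <;> rfl)
  · intro R _ L h0 hL hJ
    have hr : Set.range (Subtype.val : L → R) = L := Subtype.range_coe
    exact BooleanRng.isIdealOfCompleteOrtholattice (Subtype.val : L → R) (fun _ _ => Iff.rfl)
      ⟨⟨0, h0⟩, rfl⟩ (hr.symm ▸ hL) (hr.symm ▸ hJ)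
  · exact fun G _ R h a => h.isIdealOfCompleteOrtholattice R a
  · intro B W _ M cs
    have : Nonempty (CoxeterWeakRight cs) := ⟨(1 : W)⟩
    exact cs.isOrthogonalityRelation_weakRight.isIdealOfCompleteOrtholattice
      cs.isCompleteMeetSemilattice_weakRight
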